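/- Let $G=(V,E)$ be a finite undirected simple graph with edge costs $c:E\to\mathbb{R}_{\ge 0}$, and let $T\subseteq V$ be a set of terminals. A solution of the Steiner tree instance $(G,c,T)$ is a connected subgraph of $G$ that contains all vertices of $T$; a Steiner tree is a solution that is a tree. The cost $c(H)$ of a subgraph $H$ is the sum of the costs of its edges. A path-swap on a Steiner tree $A$ is the following operation. Choose two distinct vertices $u,v$ of $A$ and a path $f$ in $G$ from $u$ to $v$ such that no vertex of $f$ other than $u,v$ lies in $A$ and no edge of $f$ lies in $A$. Add $f$ to $A$; together with the path of $A$ from $u$ to $v$ it forms a cycle. Then remove a subpath $a$ of this cycle, i.e. delete the edges and the interior vertices of $a$, in such a way that the resulting graph is again a Steiner tree. Theorem. Let $A$ be a Steiner tree, every leaf (vertex of degree one) of which is a terminal, such that no path-swap on $A$ results in a Steiner tree of cost smaller than $c(A)$. Then $A$ is a $4$-approximation: $c(A)\le 4\,c(F)$ for every solution $F$ of the instance, in particular for every Steiner tree $F$. -/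

import Mathlib

namespace SteinerLocalSearch

variable {V : Type*} {G : SimpleGraph V}

/-- A (feasible) solution of the Steiner tree instance on `G` with terminal set `T`:
a connected subgraph of `G` that contains all terminals. -/
def IsSolution (T : Set V) (H : G.Subgraph) : Prop :=
  H.Connected ∧ T ⊆ H.verts

/-- A (feasible) Steiner tree for the terminal set `T`: a subgraph of `G` that is a tree
and contains all terminals. -/
def IsSteinerTree (T : Set V) (H : G.Subgraph) : Prop :=
  H.coe.IsTree ∧ T ⊆ H.verts

open Classical in
/-- The cost of a subgraph: the sum of the costs of its edges. -/
noncomputable def cost [Fintype V] (c : Sym2 V → ℝ) (H : G.Subgraph) : ℝ :=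
  ∑ e ∈ H.edgeSet.toFinset, c e

/-- The vertices of a walk other than its two endpoints. -/
def innerVertices {x y : V} (p : G.Walk x y) : Set V :=
  {w | w ∈ p.support ∧ w ≠ x ∧ w ≠ y}

/-- `f` can be added to `A` by a path swap: it is a path between two distinct vertices of `A`,
none of its interior vertices is in `A`, and none of its edges is in `A`
(the last point only matters when `f` is a single edge). -/
def IsAddable (A : G.Subgraph) {u v : V} (f : G.Walk u v) : Prop :=
  f.IsPath ∧ u ≠ v ∧ u ∈ A.verts ∧ v ∈ A.verts ∧
    (∀ w ∈ innerVertices f, w ∉ A.verts) ∧ (∀ e ∈ f.edges, e ∉ A.edgeSet)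

/-- The subgraph obtained from `A` by adding the path `f` and then removing the path `a`, that is,
the edges of `a` and the interior vertices of `a`. -/
def swap (A : G.Subgraph) {u v x y : V} (f : G.Walk u v) (a : G.Walk x y) : G.Subgraph :=
  ((A ⊔ f.toSubgraph).deleteEdges {e | e ∈ a.edges}).deleteVerts (innerVertices a)

/-- `B` arises from the tree `A` by a path swap: a path `f` is added to `A`; together with the
path `p` of `A` between the same endpoints it forms a cycle; a subpath `a` of this cycle (a path
all of whose edges are on the cycle) is removed; and the result `B` is again a feasible
Steiner tree. -/
def IsPathSwap (T : Set V) (A B : G.Subgraph) : Prop :=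
  ∃ (u v : V) (f p : G.Walk u v) (x y : V) (a : G.Walk x y),
    IsAddable A f ∧
    (p.IsPath ∧ p.toSubgraph ≤ A) ∧
    (a.IsPath ∧ ∀ e ∈ a.edges, e ∈ f.edges ∨ e ∈ p.edges) ∧
    B = swap A f a ∧ IsSteinerTree T B

/-- Every leaf (vertex of degree one) of `A` is a terminal. -/
def LeavesAreTerminals (T : Set V) (A : G.Subgraph) : Prop :=
  ∀ v ∈ A.verts, (∃! w, A.Adj v w) → v ∈ T

end SteinerLocalSearch

/-! Root `A` at a terminal `r`. Doubling a spanning tree of `F` gives a closed walk from `r` through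
all terminals, of cost at most `2 c(F)`. Cutting it at its visits `s 0 = r, ..., s n` to `A` gives
pieces whose interiors avoid `A`. Let `S` be the set of visited vertices of `A`; it contains `T`.
The key vertices are the non-root vertices of `A` that lie in `S` or branch. The segments that climb
from each key vertex to the next key vertex or the root cover `A`.

If exactly one end of a piece lies below a key vertex `k`, the segment of `k` lies on the cycle
which that piece closes. Its inner vertices have degree two and are not in `S`, so exchanging it for
the piece is a path swap, and local optimality bounds its cost by that of the piece
(`walkCost_segment_le`).

It remains to assign each key vertex a piece that it separates, with each piece used at most twice
(`exists_assignment`). This follows from Hall's theorem: a set `X` of key vertices cuts `A` into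
regions, at least half of those topped by `X` are visited by the walk, and the first entries into
these regions are distinct pieces separated by `X` (`card_le_two_mul_card_separated`). The two
factors of two give `4`. -/

namespace SteinerLocalSearch

open SimpleGraph

variable {V : Type*} {G : SimpleGraph V}

/-! ### Rooted trees and ancestors -/

/-- The tree `A`, rooted at `r`, is given by its parent function `p` and its depth function `d`. -/
structure RootedTree (A : G.Subgraph) (r : V) (p : V → V) (d : V → ℕ) : Prop where
  root_mem : r ∈ A.verts
  parent_root : p r = r
  adj_parent : ∀ v ∈ A.verts, v ≠ r → A.Adj v (p v)
  depth_parent : ∀ v ∈ A.verts, v ≠ r → d (p v) + 1 = d v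
  parent_of_adj : ∀ u v, A.Adj u v → p u = v ∨ p v = u

/-- Paths to `r` are unique: the parent is the second vertex of the path and the depth is its
length. If a neighbour `v` of `u` is off the path of `u`, prepending `v` gives the path of `v`. -/
theorem exists_parent_of_isTree {W : Type*} {H : SimpleGraph W} (hH : H.IsTree) (r : W) :
    ∃ (p : W → W) (d : W → ℕ), p r = r ∧ (∀ v, v ≠ r → H.Adj v (p v)) ∧
      (∀ v, v ≠ r → d (p v) + 1 = d v) ∧ ∀ u v, H.Adj u v → p u = v ∨ p v = u := by
  classical
  choose P hP hPu using fun v => hH.existsUnique_path v r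
  refine ⟨fun v => (P v).snd, fun v => (P v).length, ?_, ?_, ?_, ?_⟩
  · have : P r = Walk.nil := (hPu r _ Walk.IsPath.nil).symm
    simp [this]
  · intro v hv
    exact (P v).adj_snd (Walk.not_nil_of_ne hv)
  · intro v hv
    have hn : ¬ (P v).Nil := Walk.not_nil_of_ne hv
    change (P (P v).snd).length + 1 = (P v).length
    rw [← hPu _ _ (hP v).tail]
    exact Walk.length_tail_add_one hn
  · intro u v huv
    by_cases h : v ∈ (P u).support
    · exact Or.inl (hH.isAcyclic.eq_snd_of_adj_start (hP u) huv h).symm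
    · right
      change (P v).snd = u
      rw [← hPu v (Walk.cons huv.symm (P u)) ((hP u).cons h)]
      simp

theorem exists_rootedTree {A : G.Subgraph} (hA : A.coe.IsTree) {r : V} (hr : r ∈ A.verts) :
    ∃ p d, RootedTree A r p d := by
  classical
  obtain ⟨p, d, h1, h2, h3, h4⟩ := exists_parent_of_isTree hA ⟨r, hr⟩
  have key : ∀ v (hv : v ∈ A.verts), v ≠ r → (⟨v, hv⟩ : A.verts) ≠ ⟨r, hr⟩ := by
    intro v hv h h'
    exact h (congrArg Subtype.val h')
  -- Outside `A` the values are arbitrary; every depth and adjacency axiom concerns vertices of `A`.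
  refine ⟨fun v => if hv : v ∈ A.verts then p ⟨v, hv⟩ else v,
    fun v => if hv : v ∈ A.verts then d ⟨v, hv⟩ else 0, hr, ?_, ?_, ?_, ?_⟩
  · simp [hr, h1]
  · intro v hv hvr
    have := h2 _ (key v hv hvr)
    simpa [hv] using this
  · intro v hv hvr
    have := h3 _ (key v hv hvr)
    simpa [hv] using this
  · intro u v huv
    have hu := huv.fst_mem
    have hv := huv.snd_mem
    rcases h4 ⟨u, hu⟩ ⟨v, hv⟩ huv with h | h
    · left; simp [hu, h]
    · right; simp [hv, h]

/-- `x` is an ancestor of `v` (possibly `v` itself) with respect to the parent function `p`. -/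
def Anc (p : V → V) (x v : V) : Prop := ∃ n, p^[n] v = x

theorem Anc.refl (p : V → V) (x : V) : Anc p x x := ⟨0, rfl⟩

theorem Anc.trans {p : V → V} {x y z : V} (h : Anc p x y) (h' : Anc p y z) : Anc p x z := by
  obtain ⟨m, rfl⟩ := h
  obtain ⟨n, rfl⟩ := h'
  exact ⟨m + n, Function.iterate_add_apply p m n z⟩

theorem Anc.parent (p : V → V) (x : V) : Anc p (p x) x := ⟨1, rfl⟩

theorem Anc.of_parent {p : V → V} {x v : V} (h : Anc p x (p v)) : Anc p x v :=
  h.trans (Anc.parent p v)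

theorem Anc.eq_or_parent {p : V → V} {x v : V} (h : Anc p x v) : x = v ∨ Anc p x (p v) := by
  obtain ⟨n, rfl⟩ := h
  cases n with
  | zero => exact Or.inl rfl
  | succ n => exact Or.inr ⟨n, rfl⟩

theorem Anc.total {p : V → V} {x y v : V} (hx : Anc p x v) (hy : Anc p y v) :
    Anc p x y ∨ Anc p y x := by
  obtain ⟨m, rfl⟩ := hx
  obtain ⟨n, rfl⟩ := hy
  rcases le_total m n with h | h
  · right
    exact ⟨n - m, by rw [← Function.iterate_add_apply, Nat.sub_add_cancel h]⟩
  · left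
    exact ⟨m - n, by rw [← Function.iterate_add_apply, Nat.sub_add_cancel h]⟩

namespace RootedTree

variable {A : G.Subgraph} {r : V} {p : V → V} {d : V → ℕ}

theorem parent_mem (h : RootedTree A r p d) {v : V} (hv : v ∈ A.verts) : p v ∈ A.verts := by
  by_cases hr : v = r
  · rw [hr, h.parent_root]; exact h.root_mem
  · exact (h.adj_parent v hv hr).snd_mem

theorem iterate_mem (h : RootedTree A r p d) {v : V} (hv : v ∈ A.verts) (n : ℕ) :
    p^[n] v ∈ A.verts := by
  induction n with
  | zero => exact hv
  | succ n ih => rw [Function.iterate_succ_apply']; exact h.parent_mem ih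

theorem anc_mem (h : RootedTree A r p d) {x v : V} (hv : v ∈ A.verts) (ha : Anc p x v) :
    x ∈ A.verts := by
  obtain ⟨n, rfl⟩ := ha
  exact h.iterate_mem hv n

theorem depth_le (h : RootedTree A r p d) {x v : V} (hv : v ∈ A.verts) (ha : Anc p x v) :
    x = v ∨ d x < d v := by
  obtain ⟨n, rfl⟩ := ha
  induction n with
  | zero => exact Or.inl rfl
  | succ n ih =>
    rw [Function.iterate_succ_apply']
    by_cases hr : p^[n] v = r
    · rw [hr, h.parent_root, ← hr]; exact ih
    · have := h.depth_parent _ (h.iterate_mem hv n) hr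
      right
      rcases ih with ih | ih
      · rw [ih] at this ⊢; omega
      · omega

theorem anc_antisymm (h : RootedTree A r p d) {x y : V} (hy : y ∈ A.verts)
    (hxy : Anc p x y) (hyx : Anc p y x) : x = y := by
  have hx := h.anc_mem hy hxy
  rcases h.depth_le hy hxy with e | e
  · exact e
  · rcases h.depth_le hx hyx with e' | e'
    · exact e'.symm
    · omega

theorem anc_root (h : RootedTree A r p d) {x : V} (ha : Anc p x r) : x = r := by
  obtain ⟨n, rfl⟩ := ha
  exact Function.iterate_fixed h.parent_root n

/-- Induction from the root towards the leaves. -/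
theorem root_induction (h : RootedTree A r p d) {P : V → Prop} (hr : P r)
    (hp : ∀ v ∈ A.verts, v ≠ r → P (p v) → P v) : ∀ v ∈ A.verts, P v := by
  intro v hv
  induction hn : d v using Nat.strong_induction_on generalizing v with
  | _ n ih =>
    by_cases hvr : v = r
    · rwa [hvr]
    · have := h.depth_parent v hv hvr
      exact hp v hv hvr (ih _ (by omega) _ (h.parent_mem hv) rfl)

theorem root_anc (h : RootedTree A r p d) {v : V} (hv : v ∈ A.verts) : Anc p r v :=
  h.root_induction (P := fun v => Anc p r v) (Anc.refl p r) (fun _ _ _ ih => ih.of_parent) v hv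

/-- Induction from the leaves towards the root. -/
theorem leaf_induction [Finite V] (h : RootedTree A r p d) {P : V → Prop}
    (hp : ∀ v ∈ A.verts, (∀ w ∈ A.verts, w ≠ r → p w = v → P w) → P v) : ∀ v ∈ A.verts, P v := by
  obtain ⟨N, hN⟩ := (Set.finite_range d).bddAbove
  have hN' : ∀ v, d v ≤ N := fun v => hN ⟨v, rfl⟩
  intro v hv
  induction hn : N - d v using Nat.strong_induction_on generalizing v with
  | _ n ih =>
    refine hp v hv fun w hw hwr hwv => ?_
    have h1 := h.depth_parent w hw hwr
    have h2 := hN' w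
    rw [hwv] at h1
    exact ih _ (by omega) _ hw rfl

theorem parent_ne (h : RootedTree A r p d) {v : V} (hv : v ∈ A.verts) (hr : v ≠ r) : p v ≠ v :=
  fun e => (h.adj_parent v hv hr).ne e.symm

end RootedTree

/-! ### Costs of walks, the doubled tree and its pieces -/

/-- The cost of a walk: the sum of the costs of its edges, with multiplicity. -/
def walkCost (c : Sym2 V → ℝ) {u v : V} (q : G.Walk u v) : ℝ := (q.edges.map c).sum

@[simp] theorem walkCost_nil (c : Sym2 V → ℝ) (u : V) : walkCost c (Walk.nil : G.Walk u u) = 0 := by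
  simp [walkCost]

@[simp] theorem walkCost_cons (c : Sym2 V → ℝ) {u v w : V} (h : G.Adj u v) (q : G.Walk v w) :
    walkCost c (Walk.cons h q) = c s(u, v) + walkCost c q := by
  simp [walkCost]

@[simp] theorem walkCost_append (c : Sym2 V → ℝ) {u v w : V} (q : G.Walk u v) (q' : G.Walk v w) :
    walkCost c (q.append q') = walkCost c q + walkCost c q' := by
  simp [walkCost, Walk.edges_append]

theorem walkCost_bypass_le [DecidableEq V] {c : Sym2 V → ℝ} (hc : ∀ e ∈ G.edgeSet, 0 ≤ c e)
    {u v : V} (q : G.Walk u v) : walkCost c q.bypass ≤ walkCost c q := by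
  refine List.Sublist.sum_le_sum (q.edges_bypass_sublist_edges.map c) fun a ha => ?_
  obtain ⟨e, he, rfl⟩ := List.mem_map.mp ha
  exact hc e (q.edges_subset_edgeSet he)

open Classical in
/-- Doubling the edges of a spanning tree of `F` yields a closed walk through all vertices of `F`. -/
theorem exists_closed_walk [Fintype V] {c : Sym2 V → ℝ} (hc : ∀ e ∈ G.edgeSet, 0 ≤ c e)
    {F : G.Subgraph} (hF : F.Connected) {r : V} (hr : r ∈ F.verts) :
    ∃ W : G.Walk r r, (∀ x ∈ F.verts, x ∈ W.support) ∧ walkCost c W ≤ 2 * cost c F := by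
  -- `E` is the set of edges doubled so far, all with both ends on `W`; `n` counts the vertices that
  -- `W` misses.
  suffices H : ∀ (n : ℕ) (W : G.Walk r r) (E : Finset (Sym2 V)), (∀ e ∈ E, e ∈ F.edgeSet) →
      (∀ e ∈ E, ∀ x ∈ e, x ∈ W.support) → walkCost c W ≤ 2 * ∑ e ∈ E, c e →
      (Finset.univ.filter (· ∉ W.support)).card = n →
      ∃ W : G.Walk r r, (∀ x ∈ F.verts, x ∈ W.support) ∧ walkCost c W ≤ 2 * cost c F from
    H _ Walk.nil ∅ (by simp) (by simp) (by simp) rfl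
  intro n
  induction n using Nat.strong_induction_on with
  | _ n ih =>
    intro W E hE hEW hW hn
    by_cases hall : ∀ x ∈ F.verts, x ∈ W.support
    · refine ⟨W, hall, hW.trans ?_⟩
      have : ∑ e ∈ E, c e ≤ cost c F := by
        refine Finset.sum_le_sum_of_subset_of_nonneg (fun e he => by simpa using hE e he) ?_
        intro e he _
        exact hc e (F.edgeSet_subset (by simpa using he))
      linarith
    · push Not at hall
      obtain ⟨z, hzF, hz⟩ := hall
      obtain ⟨q, hq⟩ := (Subgraph.connected_iff_forall_exists_walk_subgraph F).mp hF |>.2 hr hzF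
      -- An edge of `F` from a visited `x` to an unvisited `y`; the walk is extended by the detour
      -- `x, y, x`.
      obtain ⟨e, he, hx, hy⟩ := q.exists_boundary_dart {x | x ∈ W.support} (by simp) hz
      obtain ⟨⟨x, y⟩, hadj⟩ := e
      simp only [Set.mem_ofPred_eq] at hx hy
      have hxyF : s(x, y) ∈ F.edgeSet := by
        apply Subgraph.edgeSet_mono hq
        rw [Walk.mem_edges_toSubgraph]
        exact List.mem_map.mpr ⟨_, he, rfl⟩
      have hsupp : ∀ z, z ∈ ((W.takeUntil x hx).append
          (Walk.cons hadj (Walk.cons hadj.symm (W.dropUntil x hx)))).support ↔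
          z ∈ W.support ∨ z = y := by
        intro z
        conv_rhs => rw [← W.take_spec hx]
        simp only [Walk.mem_support_append_iff, Walk.support_cons, List.mem_cons]
        have := (W.takeUntil x hx).end_mem_support
        grind
      refine ih _ ?_ ((W.takeUntil x hx).append
        (Walk.cons hadj (Walk.cons hadj.symm (W.dropUntil x hx)))) (insert s(x, y) E) ?_ ?_ ?_ rfl
      · rw [← hn]
        apply Finset.card_lt_card
        rw [Finset.ssubset_iff_of_subset]
        · refine ⟨y, by simpa using hy, ?_⟩
          rw [Finset.mem_filter, hsupp]
          simp
        · intro z hz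
          rw [Finset.mem_filter, hsupp] at hz
          simp only [Finset.mem_univ, true_and, Finset.mem_filter] at hz ⊢
          tauto
      · intro e he
        rcases Finset.mem_insert.mp he with rfl | he
        · exact hxyF
        · exact hE e he
      · intro e he z hz
        rw [hsupp]
        rcases Finset.mem_insert.mp he with rfl | he
        · rcases Sym2.mem_iff.mp hz with rfl | rfl
          · exact Or.inl hx
          · exact Or.inr rfl
        · exact Or.inl (hEW e he z hz)
      · have hnot : s(x, y) ∉ E := fun h => hy (hEW _ h y (by simp))
        rw [Finset.sum_insert hnot]
        have h1 : walkCost c W = walkCost c (W.takeUntil x hx) + walkCost c (W.dropUntil x hx) := by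
          rw [← walkCost_append, W.take_spec hx]
        simp only [walkCost_append, walkCost_cons, Sym2.eq_swap (a := y)]
        linarith

/-- A walk is cut at its visits of the vertex set `D` into pieces whose interiors avoid `D`. -/
theorem exists_pieces (c : Sym2 V → ℝ) (D : Set V) {u v : V} (W : G.Walk u v) (hv : v ∈ D) :
    ∃ (n : ℕ) (s : ℕ → V) (w : ℕ → ℝ) (q₀ : G.Walk u (s 0)),
      (∀ x ∈ q₀.support, x ∈ D → x = s 0) ∧ (∀ i ≤ n, s i ∈ D) ∧
      (∀ i < n, ∃ q : G.Walk (s i) (s (i + 1)),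
        (∀ x ∈ q.support, x ∈ D → x = s i ∨ x = s (i + 1)) ∧ walkCost c q ≤ w i) ∧
      (∀ x ∈ W.support, x ∈ D → ∃ i ≤ n, s i = x) ∧
      walkCost c q₀ + ∑ i ∈ Finset.range n, w i ≤ walkCost c W := by
  induction W with
  | nil =>
    rename_i u
    exact ⟨0, fun _ => u, fun _ => 0, Walk.nil, by simp, by simpa using hv, by simp,
      by simp, by simp⟩
  | cons h W ih =>
    rename_i a b e
    obtain ⟨n, s, w, q₀, h1, h2, h3, h4, h5⟩ := ih hv
    by_cases ha : a ∈ D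
    -- A start in `D` opens a new piece: the old initial part, lengthened by the first edge, becomes
    -- piece `0`, and all indices shift by one.
    · refine ⟨n + 1, fun i => Nat.casesOn i a s, fun i => Nat.casesOn i (walkCost c (Walk.cons h q₀)) w,
        Walk.nil, by simp, ?_, ?_, ?_, ?_⟩
      · rintro (_ | i) hi
        · exact ha
        · exact h2 i (by omega)
      · rintro (_ | i) hi
        · refine ⟨Walk.cons h q₀, ?_, le_rfl⟩
          intro x hx hxD
          rw [Walk.support_cons, List.mem_cons] at hx
          rcases hx with rfl | hx
          · exact Or.inl rfl
          · exact Or.inr (h1 x hx hxD)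
        · exact h3 i (by omega)
      · intro x hx hxD
        rw [Walk.support_cons, List.mem_cons] at hx
        rcases hx with rfl | hx
        · exact ⟨0, by omega, rfl⟩
        · obtain ⟨i, hi, e⟩ := h4 x hx hxD
          exact ⟨i + 1, by omega, e⟩
      · rw [Finset.sum_range_succ']
        change walkCost c Walk.nil +
          (∑ i ∈ Finset.range n, w i + walkCost c (Walk.cons h q₀)) ≤ _
        simp only [walkCost_nil, walkCost_cons]
        linarith
    · refine ⟨n, s, w, Walk.cons h q₀, ?_, h2, h3, ?_, ?_⟩
      · intro x hx hxD
        rw [Walk.support_cons, List.mem_cons] at hx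
        rcases hx with rfl | hx
        · exact absurd hxD ha
        · exact h1 x hx hxD
      · intro x hx hxD
        rw [Walk.support_cons, List.mem_cons] at hx
        rcases hx with rfl | hx
        · exact absurd hxD ha
        · exact h4 x hx hxD
      · simp only [walkCost_cons]
        linarith

/-! ### Separated pairs and Hall's condition -/

/-- `v` has at least two children. -/
def IsBranch (A : G.Subgraph) (r : V) (p : V → V) (v : V) : Prop :=
  ∃ w₁ ∈ A.verts, ∃ w₂ ∈ A.verts, w₁ ≠ r ∧ w₂ ≠ r ∧ w₁ ≠ w₂ ∧ p w₁ = v ∧ p w₂ = v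

/-- Exactly one of `u` and `v` is in the subtree below `x`. -/
def Separates (p : V → V) (x u v : V) : Prop :=
  (Anc p x u ∧ ¬ Anc p x v) ∨ (¬ Anc p x u ∧ Anc p x v)

/-- `x` is the lowest ancestor of `u` in `X`. -/
def Hits (p : V → V) (X : Finset V) (x u : V) : Prop :=
  Anc p x u ∧ ∀ y ∈ X, Anc p y u → Anc p x y → y = x

/-- `x` is the lowest proper ancestor of `y` in `X`. -/
def IsNextAbove (p : V → V) (X : Finset V) (x y : V) : Prop :=
  y ≠ x ∧ Anc p x y ∧ ∀ z ∈ X, Anc p z y → z ≠ y → Anc p z x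

namespace RootedTree

variable {A : G.Subgraph} {r : V} {p : V → V} {d : V → ℕ}

theorem exists_mem_below [Finite V] (h : RootedTree A r p d) {S : Set V}
    (hS : ∀ v ∈ A.verts, v ∈ S ∨ ∃ w ∈ A.verts, w ≠ r ∧ p w = v) :
    ∀ v ∈ A.verts, ∃ s ∈ S, s ∈ A.verts ∧ Anc p v s := by
  refine h.leaf_induction fun v hv ih => ?_
  rcases hS v hv with hs | ⟨w, hw, hwr, rfl⟩
  · exact ⟨v, hs, hv, Anc.refl p v⟩
  · obtain ⟨s, hs, hsA, ha⟩ := ih w hw hwr rfl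
    exact ⟨s, hs, hsA, (Anc.parent p w).trans ha⟩

/-- Below each child of a vertex of `X` that is hit by no vertex of `S` there is an element
of `X` next to it. -/
theorem exists_isNextAbove [Finite V] (h : RootedTree A r p d) {S : Set V}
    (hS : ∀ v ∈ A.verts, v ∈ S ∨ ∃ w ∈ A.verts, w ≠ r ∧ p w = v) {X : Finset V}
    (hX : ∀ x ∈ X, x ∈ A.verts) {x w : V}
    (hno : ∀ s ∈ S, ¬ Hits p X x s) (hw : w ∈ A.verts) (hwr : w ≠ r) (hwx : p w = x) :
    ∃ y ∈ X, Anc p w y ∧ IsNextAbove p X x y := by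
  classical
  have hxw : Anc p x w := hwx ▸ Anc.parent p w
  have hxne : x ≠ w := hwx ▸ h.parent_ne hw hwr
  -- The ancestors of a vertex form a chain, and none lies strictly between `w` and its parent `x`.
  have cases_anc : ∀ z v, Anc p w v → Anc p z v → Anc p w z ∨ Anc p z x := by
    intro z v hwv hzv
    rcases hwv.total hzv with ha | ha
    · exact Or.inl ha
    · rcases ha.eq_or_parent with rfl | ha
      · exact Or.inl (Anc.refl p _)
      · exact Or.inr (hwx ▸ ha)
  obtain ⟨s, hs, hsA, hws⟩ := h.exists_mem_below hS w hw
  have hne : (X.filter (Anc p w ·)).Nonempty := by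
    by_contra hempty
    rw [Finset.not_nonempty_iff_eq_empty, Finset.filter_eq_empty_iff] at hempty
    refine hno s hs ⟨hxw.trans hws, fun y hy hys hxy => ?_⟩
    rcases cases_anc y s hws hys with ha | ha
    · exact absurd ha (hempty hy)
    · exact (h.anc_antisymm (hX y hy) hxy ha).symm
  -- A topmost element of `X` below `w`.
  obtain ⟨y, hy, hmin⟩ := Finset.exists_min_image _ d hne
  obtain ⟨hyX, hwy⟩ := Finset.mem_filter.mp hy
  refine ⟨y, hyX, hwy, ?_, hxw.trans hwy, fun z hz hzy hne => ?_⟩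
  · rintro rfl
    exact hxne (h.anc_antisymm hw hxw hwy)
  · rcases cases_anc z y hwy hzy with ha | ha
    · have h1 := hmin z (Finset.mem_filter.mpr ⟨hz, ha⟩)
      rcases h.depth_le (hX y hyX) hzy with e | e
      · exact absurd e hne
      · omega
    · exact ha

/-- Each vertex of `U` has an element of `X` next below it in each of two child subtrees, and an
element of `X` is next below at most one vertex. -/
theorem two_mul_card_le [Finite V] (h : RootedTree A r p d) {S : Set V}
    (hS : ∀ v ∈ A.verts, v ∈ S ∨ ∃ w ∈ A.verts, w ≠ r ∧ p w = v) {X U : Finset V}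
    (hX : ∀ x ∈ X, x ∈ A.verts) (hU : ∀ x ∈ U, x ∈ X ∧ IsBranch A r p x ∧ ∀ s ∈ S, ¬ Hits p X x s) :
    2 * U.card ≤ X.card := by
  classical
  have hdis : (U : Set V).PairwiseDisjoint fun x => X.filter (IsNextAbove p X x ·) := by
    intro x hx x' hx' hne
    refine Finset.disjoint_left.mpr fun y hy hy' => hne ?_
    obtain ⟨-, h1, h2, h3⟩ := Finset.mem_filter.mp hy
    obtain ⟨-, h1', h2', h3'⟩ := Finset.mem_filter.mp hy'
    have hxX := (hU x hx).1
    have hxX' := (hU x' hx').1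
    exact h.anc_antisymm (hX _ hxX') (h3' x hxX h2 h1.symm) (h3 x' hxX' h2' h1'.symm)
  calc 2 * U.card = ∑ x ∈ U, 2 := by simp [mul_comm]
    _ ≤ ∑ x ∈ U, (X.filter (IsNextAbove p X x ·)).card := by
      refine Finset.sum_le_sum fun x hx => ?_
      obtain ⟨hxX, ⟨w₁, hw₁, w₂, hw₂, hr₁, hr₂, hne, hp₁, hp₂⟩, hno⟩ := hU x hx
      obtain ⟨y₁, hy₁, ha₁, hn₁⟩ := h.exists_isNextAbove hS hX hno hw₁ hr₁ hp₁
      obtain ⟨y₂, hy₂, ha₂, hn₂⟩ := h.exists_isNextAbove hS hX hno hw₂ hr₂ hp₂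
      refine Finset.one_lt_card.mpr ⟨y₁, Finset.mem_filter.mpr ⟨hy₁, hn₁⟩, y₂,
        Finset.mem_filter.mpr ⟨hy₂, hn₂⟩, ?_⟩
      -- Two siblings have equal depth, so they cannot both be ancestors of one vertex.
      rintro rfl
      have hd₁ := h.depth_parent w₁ hw₁ hr₁
      have hd₂ := h.depth_parent w₂ hw₂ hr₂
      rw [hp₁] at hd₁
      rw [hp₂] at hd₂
      rcases ha₁.total ha₂ with ha | ha
      · rcases h.depth_le hw₂ ha with e | e
        · exact hne e
        · omega
      · rcases h.depth_le hw₁ ha with e | e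
        · exact hne e.symm
        · omega
    _ = (U.biUnion fun x => X.filter (IsNextAbove p X x ·)).card := (Finset.card_biUnion hdis).symm
    _ ≤ X.card := Finset.card_le_card (Finset.biUnion_subset.mpr fun _ _ => Finset.filter_subset _ _)

/-- The sequence starts at the root, outside the region of `x`; the step sought is its first entry
into that region. -/
theorem exists_separates_of_hits (h : RootedTree A r p d) {X : Finset V} {s : ℕ → V} (hs : s 0 = r)
    {x : V} (hxX : x ∈ X) (hx : x ≠ r) {i : ℕ} (hi : Hits p X x (s i)) :
    ∃ j < i, Hits p X x (s (j + 1)) ∧ ∃ z ∈ X, Separates p z (s j) (s (j + 1)) := by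
  classical
  have hex : ∃ i, Hits p X x (s i) := ⟨i, hi⟩
  have hf := Nat.find_spec hex
  have hle := Nat.find_min' hex hi
  rcases hj : Nat.find hex with _ | j
  · rw [hj, hs] at hf
    exact absurd (h.anc_root hf.1) hx
  · have hnot : ¬ Hits p X x (s j) := Nat.find_min hex (by omega)
    rw [hj] at hf
    refine ⟨j, by omega, hf, ?_⟩
    -- Before the entry, `s j` is either in the region of a lower `y`, which then separates, or not
    -- below `x` at all.
    by_cases ha : Anc p x (s j)
    · have : ∃ y ∈ X, Anc p y (s j) ∧ Anc p x y ∧ y ≠ x := by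
        by_contra hcon
        push Not at hcon
        exact hnot ⟨ha, hcon⟩
      obtain ⟨y, hy, hys, hxy, hne⟩ := this
      exact ⟨y, hy, Or.inl ⟨hys, fun hy' => hne (hf.2 y hy hy' hxy)⟩⟩
    · exact ⟨x, hxX, Or.inr ⟨ha, hf.1⟩⟩

open Classical in
-- Unhit vertices are outside `S`, hence branch, so they make up at most half of `X`. Hit vertices
-- inject into separated pairs by first entry, since the end of a pair determines the region
-- entered.
theorem card_le_two_mul_card_separated [Finite V] (h : RootedTree A r p d) {n : ℕ} {s : ℕ → V}
    (hs : s 0 = r)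
    (hS : ∀ v ∈ A.verts, (∃ i ≤ n, s i = v) ∨ ∃ w ∈ A.verts, w ≠ r ∧ p w = v) {X : Finset V}
    (hX : ∀ x ∈ X, x ∈ A.verts) (hXr : ∀ x ∈ X, x ≠ r)
    (hXS : ∀ x ∈ X, (∃ i ≤ n, s i = x) ∨ IsBranch A r p x) :
    X.card ≤ 2 * ((Finset.range n).filter
      fun j => ∃ x ∈ X, Separates p x (s j) (s (j + 1))).card := by
  have h1 : 2 * (X.filter fun x => ¬ ∃ i ≤ n, Hits p X x (s i)).card ≤ X.card := by
    refine h.two_mul_card_le (S := {v | ∃ i ≤ n, s i = v}) hS hX fun x hx => ?_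
    obtain ⟨hxX, hx⟩ := Finset.mem_filter.mp hx
    refine ⟨hxX, (hXS x hxX).resolve_left ?_, ?_⟩
    · rintro ⟨i, hi, rfl⟩
      exact hx ⟨i, hi, Anc.refl p _, fun y hy hys hsy =>
        h.anc_antisymm (hX _ hxX) hys hsy⟩
    · rintro _ ⟨i, hi, rfl⟩ hh
      exact hx ⟨i, hi, hh⟩
  have h2 : (X.filter fun x => ∃ i ≤ n, Hits p X x (s i)).card ≤ ((Finset.range n).filter
      fun j => ∃ x ∈ X, Separates p x (s j) (s (j + 1))).card := by
    have hex : ∀ x : V, ∃ j, x ∈ X.filter (fun x => ∃ i ≤ n, Hits p X x (s i)) →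
        j < n ∧ Hits p X x (s (j + 1)) ∧ ∃ z ∈ X, Separates p z (s j) (s (j + 1)) := by
      intro x
      by_cases hx : x ∈ X.filter (fun x => ∃ i ≤ n, Hits p X x (s i))
      · obtain ⟨hxX, i, hi, hh⟩ := Finset.mem_filter.mp hx
        obtain ⟨j, hj, hj'⟩ := h.exists_separates_of_hits hs hxX (hXr x hxX) hh
        exact ⟨j, fun _ => ⟨by omega, hj'⟩⟩
      · exact ⟨0, fun hx' => absurd hx' hx⟩
    choose f hf using hex
    refine Finset.card_le_card_of_injOn f (fun x hx => ?_) fun x hx y hy hxy => ?_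
    · have := hf x hx
      exact Finset.mem_coe.mpr (Finset.mem_filter.mpr ⟨Finset.mem_range.mpr this.1, this.2.2⟩)
    · have h1 := (hf x hx).2.1
      have h2 := (hf y hy).2.1
      rw [hxy] at h1
      have hxX := (Finset.mem_filter.mp hx).1
      have hyX := (Finset.mem_filter.mp hy).1
      rcases h1.1.total h2.1 with ha | ha
      · exact (h1.2 y hyX h2.1 ha).symm
      · exact h2.2 x hxX h1.1 ha
  have h3 := Finset.card_filter_add_card_filter_not (s := X) (fun x => ∃ i ≤ n, Hits p X x (s i))
  omega

/-- Every vertex of `K` is assigned a separated pair of consecutive vertices in such a way that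
every pair is used at most twice. -/
theorem exists_assignment [Finite V] (h : RootedTree A r p d) {n : ℕ} {s : ℕ → V} (hs : s 0 = r)
    (hS : ∀ v ∈ A.verts, (∃ i ≤ n, s i = v) ∨ ∃ w ∈ A.verts, w ≠ r ∧ p w = v) {K : Finset V}
    (hK : ∀ x ∈ K, x ∈ A.verts) (hKr : ∀ x ∈ K, x ≠ r)
    (hKS : ∀ x ∈ K, (∃ i ≤ n, s i = x) ∨ IsBranch A r p x) :
    ∃ g : K → ℕ × Bool, Function.Injective g ∧
      ∀ k : K, (g k).1 < n ∧ Separates p k (s (g k).1) (s ((g k).1 + 1)) := by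
  classical
  -- The factor `Bool` provides two copies of each pair, so Hall's theorem yields an assignment of
  -- multiplicity at most two.
  let t : K → Finset (ℕ × Bool) := fun k =>
    ((Finset.range n).filter fun j => Separates p k (s j) (s (j + 1))) ×ˢ Finset.univ
  obtain ⟨g, hg, hgt⟩ := (Finset.all_card_le_biUnion_card_iff_exists_injective t).mp (by
    intro X
    have := h.card_le_two_mul_card_separated hs hS (X := X.map ⟨Subtype.val, Subtype.val_injective⟩)
      (by simp only [Finset.mem_map]; rintro _ ⟨x, -, rfl⟩; exact hK x x.2)
      (by simp only [Finset.mem_map]; rintro _ ⟨x, -, rfl⟩; exact hKr x x.2)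
      (by simp only [Finset.mem_map]; rintro _ ⟨x, -, rfl⟩; exact hKS x x.2)
    rw [Finset.card_map] at this
    refine this.trans ?_
    have hcard : 2 * ((Finset.range n).filter fun j => ∃ x ∈ X.map ⟨Subtype.val,
        Subtype.val_injective⟩, Separates p x (s j) (s (j + 1))).card =
        (((Finset.range n).filter fun j => ∃ x ∈ X.map ⟨Subtype.val,
        Subtype.val_injective⟩, Separates p x (s j) (s (j + 1))) ×ˢ
          (Finset.univ : Finset Bool)).card := by
      rw [Finset.card_product]; simp [mul_comm]
    rw [hcard]
    refine Finset.card_le_card fun ⟨j, b⟩ hj => ?_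
    obtain ⟨hj, x, hx, hsep⟩ := Finset.mem_filter.mp (Finset.mem_product.mp hj).1
    obtain ⟨k, hk, rfl⟩ := Finset.mem_map.mp hx
    exact Finset.mem_biUnion.mpr ⟨k, hk, Finset.mem_product.mpr
      ⟨Finset.mem_filter.mpr ⟨hj, hsep⟩, Finset.mem_univ _⟩⟩)
  refine ⟨g, hg, fun k => ?_⟩
  have := Finset.mem_filter.mp (Finset.mem_product.mp (hgt k)).1
  exact ⟨Finset.mem_range.mp this.1, this.2⟩

end RootedTree

/-! ### Segments of the tree -/

/-- Going up `n` steps from `k` in the tree `A`, one meets no branching vertex and no vertex of `S`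
strictly in between. -/
structure IsSegment (A : G.Subgraph) (r : V) (p : V → V) (S : Set V) (k : V) (n : ℕ) : Prop where
  mem : k ∈ A.verts
  pos : 0 < n
  ne_root : ∀ j < n, p^[j] k ≠ r
  notMem : ∀ j, 0 < j → j < n → p^[j] k ∉ S
  not_isBranch : ∀ j, 0 < j → j < n → ¬ IsBranch A r p (p^[j] k)

namespace RootedTree

variable {A : G.Subgraph} {r : V} {p : V → V} {d : V → ℕ}

theorem exists_walk_up (h : RootedTree A r p d) {v u : V} (hv : v ∈ A.verts) {n : ℕ}
    (hn : ∀ j < n, p^[j] v ≠ r) (hu : p^[n] v = u) : ∃ a : G.Walk v u,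
      a.support = (List.range (n + 1)).map (fun j => p^[j] v) ∧
      a.edges = (List.range n).map (fun j => s(p^[j] v, p^[j + 1] v)) := by
  induction n generalizing v with
  | zero =>
    obtain rfl : v = u := hu
    exact ⟨Walk.nil, by simp, by simp⟩
  | succ n ih =>
    have hvr : v ≠ r := hn 0 (by omega)
    obtain ⟨a, h1, h2⟩ := ih (h.parent_mem hv) (fun j hj => hn (j + 1) (by omega)) hu
    refine ⟨Walk.cons (A.adj_sub (h.adj_parent v hv hvr)) a, ?_, ?_⟩
    · rw [Walk.support_cons, h1, List.range_succ_eq_map (n := n + 1), List.map_cons, List.map_map]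
      rfl
    · rw [Walk.edges_cons, h2, List.range_succ_eq_map (n := n), List.map_cons, List.map_map]
      rfl

theorem depth_iterate (h : RootedTree A r p d) {v : V} (hv : v ∈ A.verts) {n : ℕ}
    (hn : ∀ j < n, p^[j] v ≠ r) : d (p^[n] v) + n = d v := by
  induction n with
  | zero => rfl
  | succ n ih =>
    have h1 := ih fun j hj => hn j (by omega)
    have h2 := h.depth_parent _ (h.iterate_mem hv n) (hn n (by omega))
    rw [Function.iterate_succ_apply']
    omega

theorem iterate_injOn (h : RootedTree A r p d) {v : V} (hv : v ∈ A.verts) {n : ℕ}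
    (hn : ∀ j < n, p^[j] v ≠ r) {i j : ℕ} (hi : i ≤ n) (hj : j ≤ n) (hij : p^[i] v = p^[j] v) :
    i = j := by
  have h1 := h.depth_iterate hv (n := i) fun l hl => hn l (by omega)
  have h2 := h.depth_iterate hv (n := j) fun l hl => hn l (by omega)
  rw [hij] at h1
  omega

theorem isPath_of_support_eq (h : RootedTree A r p d) {v u : V} (hv : v ∈ A.verts) {n : ℕ}
    (hn : ∀ j < n, p^[j] v ≠ r) {a : G.Walk v u}
    (ha : a.support = (List.range (n + 1)).map (fun j => p^[j] v)) : a.IsPath := by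
  rw [Walk.isPath_def, ha]
  refine List.Nodup.map_on (fun i hi j hj hij => ?_) List.nodup_range
  rw [List.mem_range] at hi hj
  exact h.iterate_injOn hv hn (by omega) (by omega) hij

theorem exists_child_of_anc (h : RootedTree A r p d) {x v : V} (hv : v ∈ A.verts)
    (ha : Anc p x v) (hne : x ≠ v) : ∃ w ∈ A.verts, w ≠ r ∧ p w = x ∧ Anc p w v := by
  obtain ⟨n, rfl⟩ := ha
  induction n with
  | zero => exact absurd rfl hne
  | succ n ih =>
    rw [Function.iterate_succ_apply'] at hne ⊢
    by_cases hr : p^[n] v = r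
    · have e : p (p^[n] v) = p^[n] v := by rw [hr, h.parent_root]
      rw [e] at hne ⊢
      exact ih hne
    · exact ⟨_, h.iterate_mem hv n, hr, rfl, n, rfl⟩

/-- An edge of `A` determines its lower endpoint. -/
theorem eq_of_edge_eq (h : RootedTree A r p d) {v w : V} (hv : v ∈ A.verts) (hvr : v ≠ r)
    (hw : w ∈ A.verts) (hwr : w ≠ r) (e : s(v, p v) = s(w, p w)) : v = w := by
  rcases Sym2.eq_iff.mp e with ⟨e, -⟩ | ⟨e, e'⟩
  · exact e
  · have h1 := h.depth_parent v hv hvr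
    have h2 := h.depth_parent w hw hwr
    rw [e'] at h1
    rw [← e] at h2
    omega

/-- The only child of an inner vertex of a segment is the preceding vertex of the segment. -/
theorem child_of_inner (h : RootedTree A r p d) {S : Set V} {k : V} {n : ℕ}
    (hk : IsSegment A r p S k n) {j : ℕ} (hj : j + 1 < n) {w : V} (hw : w ∈ A.verts) (hwr : w ≠ r)
    (e : p w = p^[j + 1] k) : w = p^[j] k := by
  by_contra hne
  exact hk.not_isBranch (j + 1) (by omega) hj ⟨w, hw, p^[j] k, h.iterate_mem hk.mem j, hwr,
    hk.ne_root j (by omega), hne, e, (Function.iterate_succ_apply' p j k).symm⟩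

/-- Inner vertices of a segment have a single child, so descending from one leads down the segment
until `k`. -/
theorem anc_of_anc_iterate (h : RootedTree A r p d) {S : Set V} {k : V} {n : ℕ}
    (hk : IsSegment A r p S k n) {j : ℕ} (hj : j < n) {v : V} (hv : v ∈ A.verts)
    (ha : Anc p (p^[j] k) v) : (∃ i, 0 < i ∧ i ≤ j ∧ v = p^[i] k) ∨ Anc p k v := by
  induction j with
  | zero => exact Or.inr ha
  | succ j ih =>
    by_cases e : p^[j + 1] k = v
    · exact Or.inl ⟨j + 1, by omega, le_rfl, e.symm⟩
    · obtain ⟨w, hw, hwr, hpw, hwv⟩ := h.exists_child_of_anc hv ha e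
      rw [h.child_of_inner hk hj hw hwr hpw] at hwv
      rcases ih (by omega) hwv with ⟨i, h1, h2, h3⟩ | h1
      · exact Or.inl ⟨i, h1, by omega, h3⟩
      · exact Or.inr h1

/-- The edge from `x` to its parent is the only edge of `A` that leaves the subtree below `x`. -/
theorem edge_mem_of_separated (h : RootedTree A r p d) {x s s' : V} (hs : Anc p x s)
    (hs' : ¬ Anc p x s') {q : G.Walk s s'} (hq : q.toSubgraph ≤ A) : s(x, p x) ∈ q.edges := by
  obtain ⟨⟨⟨a, b⟩, hadj⟩, he, ha, hb⟩ := q.exists_boundary_dart {v | Anc p x v} hs hs'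
  have hmem : s(a, b) ∈ q.edges := List.mem_map.mpr ⟨_, he, rfl⟩
  have hab : A.Adj a b := Subgraph.edgeSet_mono hq (q.mem_edges_toSubgraph.mpr hmem)
  change Anc p x a at ha
  change ¬ Anc p x b at hb
  rcases h.parent_of_adj a b hab with e | e
  · rcases ha.eq_or_parent with e' | e'
    · rw [e', e]; exact hmem
    · rw [e] at e'; exact absurd e' hb
  · exact absurd (Anc.of_parent (e ▸ ha)) hb

theorem not_anc_iterate (h : RootedTree A r p d) {S : Set V} {k : V} {n : ℕ}
    (hk : IsSegment A r p S k n) {j : ℕ} (hj : j < n) {s : V} (hs : s ∈ A.verts) (hsS : s ∈ S)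
    (ha : ¬ Anc p k s) : ¬ Anc p (p^[j] k) s := by
  intro hanc
  rcases h.anc_of_anc_iterate hk hj hs hanc with ⟨i, h1, h2, rfl⟩ | h1
  · exact hk.notMem i h1 (by omega) hsS
  · exact ha h1

end RootedTree

/-! ### Connectivity, cost and vertex count of a swap -/

theorem connected_of_reachable {B : G.Subgraph} {r : V} (hr : r ∈ B.verts)
    (hB : ∀ v ∈ B.verts, B.spanningCoe.Reachable v r) : B.Connected := by
  have key : ∀ v, B.spanningCoe.Reachable v r → ∃ q : G.Walk v r, q.toSubgraph ≤ B := by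
    rintro v ⟨q⟩
    induction q with
    | nil => exact ⟨Walk.nil, by simpa using hr⟩
    | cons hadj q ih =>
      obtain ⟨q', hq'⟩ := ih hr hB
      have hadj' : B.Adj _ _ := hadj
      refine ⟨Walk.cons (B.adj_sub hadj') q', ?_⟩
      rw [Walk.toSubgraph]
      exact sup_le (subgraphOfAdj_le_of_adj B hadj') hq'
  rw [Subgraph.connected_iff_forall_exists_walk_subgraph]
  refine ⟨⟨r, hr⟩, fun {u v} hu hv => ?_⟩
  obtain ⟨q, hq⟩ := key u (hB u hu)
  obtain ⟨q', hq'⟩ := key v (hB v hv)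
  refine ⟨q.append q'.reverse, ?_⟩
  rw [Walk.toSubgraph_append, Walk.toSubgraph_reverse]
  exact sup_le hq hq'

open Classical in
theorem natCard_coe_edgeSet [Fintype V] (H : G.Subgraph) :
    Nat.card H.coe.edgeSet = H.edgeSet.toFinset.card := by
  rw [← Set.ncard_eq_toFinset_card', ← Subgraph.image_coe_edgeSet_coe,
    Set.ncard_image_of_injective _ (Sym2.map.injective Subtype.val_injective)]
  rfl

/-- With unit costs, `cost_swap` becomes a count of edges. -/
theorem cost_one [Fintype V] (H : G.Subgraph) :
    cost (fun _ => 1) H = Nat.card H.coe.edgeSet := by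
  rw [natCard_coe_edgeSet, cost]
  simp

theorem walkCost_one {u v : V} (q : G.Walk u v) : walkCost (fun _ => 1) q = q.length := by
  simp [walkCost]

theorem walkCost_eq_sum [DecidableEq V] (c : Sym2 V → ℝ) {u v : V} {q : G.Walk u v}
    (hq : q.IsPath) : walkCost c q = ∑ e ∈ q.edges.toFinset, c e :=
  (List.sum_toFinset c hq.isTrail.edges_nodup).symm

theorem swap_verts (A : G.Subgraph) {u v x y : V} (f : G.Walk u v) (a : G.Walk x y) :
    (swap A f a).verts = (A.verts ∪ {w | w ∈ f.support}) \ innerVertices a := by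
  simp [swap, Walk.verts_toSubgraph]

/-- If no vertex removed by a swap is incident to a remaining edge, then the swap removes exactly
the edges of the removed path. -/
theorem swap_edgeSet {A : G.Subgraph} {u v x y : V} {f : G.Walk u v} {a : G.Walk x y}
    (h : ∀ e, e ∈ A.edgeSet ∨ e ∈ f.edges → ∀ w ∈ innerVertices a, w ∈ e → e ∈ a.edges) :
    (swap A f a).edgeSet = (A.edgeSet ∪ {e | e ∈ f.edges}) \ {e | e ∈ a.edges} := by
  ext e
  induction e with
  | _ w z =>
    have hmem : s(w, z) ∈ (A ⊔ f.toSubgraph).edgeSet ↔ s(w, z) ∈ A.edgeSet ∨ s(w, z) ∈ f.edges := by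
      rw [Subgraph.edgeSet_sup, Set.mem_union, Walk.mem_edges_toSubgraph]
    rw [Subgraph.mem_edgeSet, swap, Subgraph.deleteVerts_adj, Subgraph.deleteEdges_adj,
      Subgraph.deleteEdges_verts]
    rw [Subgraph.mem_edgeSet] at hmem
    constructor
    · rintro ⟨-, -, -, -, h1, h2⟩
      exact ⟨hmem.mp h1, h2⟩
    · rintro ⟨h1, h2⟩
      have h3 := hmem.mpr h1
      exact ⟨h3.fst_mem, fun hw => h2 (h _ h1 w hw (by simp)), h3.snd_mem,
        fun hz => h2 (h _ h1 z hz (by simp)), h3, h2⟩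

theorem cost_swap [Fintype V] (c : Sym2 V → ℝ) {A : G.Subgraph} {u v x y : V} {f : G.Walk u v}
    {a : G.Walk x y} (hf : f.IsPath) (ha : a.IsPath) (hfA : ∀ e ∈ f.edges, e ∉ A.edgeSet)
    (haA : ∀ e ∈ a.edges, e ∈ A.edgeSet)
    (hB : (swap A f a).edgeSet = (A.edgeSet ∪ {e | e ∈ f.edges}) \ {e | e ∈ a.edges}) :
    cost c (swap A f a) + walkCost c a = cost c A + walkCost c f := by
  classical
  rw [walkCost_eq_sum c hf, walkCost_eq_sum c ha]
  unfold cost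
  rw [← Finset.sum_union (Finset.disjoint_left.mpr ?_), ← Finset.sum_union
    (Finset.disjoint_left.mpr ?_)]
  · refine Finset.sum_congr ?_ fun _ _ => rfl
    ext e
    have := haA e
    simp only [hB, Finset.mem_union, Set.mem_toFinset, List.mem_toFinset, Set.mem_sdiff,
      Set.mem_union, Set.mem_ofPred_eq]
    tauto
  · intro e he he'
    exact hfA e (List.mem_toFinset.mp he') (Set.mem_toFinset.mp he)
  · intro e he he'
    rw [Set.mem_toFinset, hB] at he
    exact he.2 (List.mem_toFinset.mp he')

open Classical in
theorem card_innerVertices [Fintype V] {x y : V} {a : G.Walk x y} (ha : a.IsPath) (hxy : x ≠ y) :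
    (innerVertices a).toFinset.card + 2 = a.length + 1 := by
  have h1 : (innerVertices a).toFinset = a.support.toFinset \ {x, y} := by
    ext w
    rw [Set.mem_toFinset]
    simp [innerVertices]
  rw [h1, ← Finset.card_pair hxy, Finset.card_sdiff_add_card_eq_card,
    List.toFinset_card_of_nodup ha.support_nodup, Walk.length_support]
  intro w hw
  rcases Finset.mem_insert.mp hw with rfl | hw
  · simp
  · rw [Finset.mem_singleton.mp hw]; simp

/-- A path of length `l` between distinct ends has `l - 1` inner vertices; those of `f` are new and
those of `a` are lost. -/
theorem card_swap_verts [Fintype V] {A : G.Subgraph} {u v x y : V} {f : G.Walk u v}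
    {a : G.Walk x y} (hf : IsAddable A f) (ha : a.IsPath) (hxy : x ≠ y)
    (haA : ∀ w ∈ a.support, w ∈ A.verts) :
    Nat.card (swap A f a).verts + a.length = Nat.card A.verts + f.length := by
  classical
  obtain ⟨hfp, huv, hu, hv, hin, -⟩ := hf
  have h1 := card_innerVertices ha hxy
  have h2 := card_innerVertices hfp huv
  have hverts : (swap A f a).verts.toFinset =
      (A.verts.toFinset ∪ (innerVertices f).toFinset) \ (innerVertices a).toFinset := by
    ext w
    simp only [Set.mem_toFinset, swap_verts, Finset.mem_sdiff, Finset.mem_union, Set.mem_sdiff,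
      Set.mem_union, Set.mem_ofPred_eq]
    refine and_congr_left fun _ => ⟨?_, ?_⟩
    · rintro (hw | hw)
      · exact Or.inl hw
      · by_cases e : w = u
        · exact Or.inl (e ▸ hu)
        · by_cases e' : w = v
          · exact Or.inl (e' ▸ hv)
          · exact Or.inr ⟨hw, e, e'⟩
    · rintro (hw | hw)
      · exact Or.inl hw
      · exact Or.inr hw.1
  have hdis : Disjoint A.verts.toFinset (innerVertices f).toFinset :=
    Finset.disjoint_left.mpr fun w hw hw' =>
      hin w (Set.mem_toFinset.mp hw') (Set.mem_toFinset.mp hw)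
  have hsub : (innerVertices a).toFinset ⊆ A.verts.toFinset ∪ (innerVertices f).toFinset := by
    intro w hw
    exact Finset.mem_union_left _ (Set.mem_toFinset.mpr (haA w (Set.mem_toFinset.mp hw).1))
  have h3 := Finset.card_sdiff_add_card_eq_card hsub
  rw [← hverts, Finset.card_union_of_disjoint hdis] at h3
  have e1 : Nat.card (swap A f a).verts = (swap A f a).verts.toFinset.card := by
    rw [← Set.ncard_eq_toFinset_card']; rfl
  have e2 : Nat.card A.verts = A.verts.toFinset.card := by
    rw [← Set.ncard_eq_toFinset_card']; rfl
  omega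

/-! ### Exchanging a segment for a piece -/

namespace RootedTree

variable {A : G.Subgraph} {r : V} {p : V → V} {d : V → ℕ} {S : Set V} {k u : V} {n : ℕ}
  {a : G.Walk k u}

theorem edges_segment_mem (h : RootedTree A r p d) (hk : IsSegment A r p S k n)
    (hae : a.edges = (List.range n).map (fun j => s(p^[j] k, p^[j + 1] k))) :
    ∀ e ∈ a.edges, e ∈ A.edgeSet := by
  intro e he
  rw [hae, List.mem_map] at he
  obtain ⟨j, hj, rfl⟩ := he
  rw [List.mem_range] at hj
  rw [Function.iterate_succ_apply']
  exact h.adj_parent _ (h.iterate_mem hk.mem j) (hk.ne_root j hj)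

theorem mem_innerVertices_segment (h : RootedTree A r p d) (hk : IsSegment A r p S k n)
    (hu : p^[n] k = u) (has : a.support = (List.range (n + 1)).map (fun j => p^[j] k)) {w : V} :
    w ∈ innerVertices a ↔ ∃ j, j + 1 < n ∧ w = p^[j + 1] k := by
  constructor
  · rintro ⟨hw, hwk, hwu⟩
    rw [has, List.mem_map] at hw
    obtain ⟨j, hj, rfl⟩ := hw
    rw [List.mem_range] at hj
    rcases j with _ | j
    · exact absurd rfl hwk
    · refine ⟨j, lt_of_le_of_ne (by omega) ?_, rfl⟩
      rintro rfl
      exact hwu hu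
  · rintro ⟨j, hj, rfl⟩
    refine ⟨?_, fun e => ?_, fun e => ?_⟩
    · rw [has, List.mem_map]
      exact ⟨j + 1, List.mem_range.mpr (by omega), rfl⟩
    · have := h.iterate_injOn hk.mem hk.ne_root (i := j + 1) (j := 0) (by omega) (by omega) e
      omega
    · have := h.iterate_injOn hk.mem hk.ne_root (i := j + 1) (j := n) (by omega) le_rfl
        (e.trans hu.symm)
      omega

theorem parent_edge_notMem_segment (h : RootedTree A r p d) (hk : IsSegment A r p S k n)
    (hae : a.edges = (List.range n).map (fun j => s(p^[j] k, p^[j + 1] k))) {v : V}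
    (hv : v ∈ A.verts) (hvr : v ≠ r) (hne : ∀ j < n, v ≠ p^[j] k) : s(v, p v) ∉ a.edges := by
  intro he
  rw [hae, List.mem_map] at he
  obtain ⟨j, hj, he⟩ := he
  rw [List.mem_range] at hj
  rw [Function.iterate_succ_apply'] at he
  exact hne j hj
    (h.eq_of_edge_eq hv hvr (h.iterate_mem hk.mem j) (hk.ne_root j hj) he.symm)

theorem edge_of_inner (h : RootedTree A r p d) (hk : IsSegment A r p S k n) (hu : p^[n] k = u)
    (has : a.support = (List.range (n + 1)).map (fun j => p^[j] k))
    (hae : a.edges = (List.range n).map (fun j => s(p^[j] k, p^[j + 1] k))) {e : Sym2 V}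
    (he : e ∈ A.edgeSet) {w : V} (hw : w ∈ innerVertices a) (hwe : w ∈ e) : e ∈ a.edges := by
  obtain ⟨j, hj, rfl⟩ := (h.mem_innerVertices_segment hk hu has).mp hw
  obtain ⟨z, rfl⟩ := Sym2.mem_iff_exists.mp hwe
  have hadj : A.Adj (p^[j + 1] k) z := he
  rw [hae, List.mem_map]
  rcases h.parent_of_adj _ _ hadj with e | e
  · exact ⟨j + 1, List.mem_range.mpr hj, by rw [Function.iterate_succ_apply' p (j + 1), e]⟩
  · have hzr : z ≠ r := by
      rintro rfl
      rw [h.parent_root] at e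
      exact hadj.ne e.symm
    have := h.child_of_inner hk hj hadj.snd_mem hzr e
    exact ⟨j, List.mem_range.mpr (by omega), by rw [this, Sym2.eq_swap]⟩

/-- Adding a path between the two sides of a segment and removing the segment preserves
connectivity. -/
theorem connected_swap (h : RootedTree A r p d) (hk : IsSegment A r p S k n)
    (hu : p^[n] k = u) (has : a.support = (List.range (n + 1)).map (fun j => p^[j] k))
    (hae : a.edges = (List.range n).map (fun j => s(p^[j] k, p^[j + 1] k)))
    {s s' : V} {f : G.Walk s s'} (hf : IsAddable A f)
    (hs' : s' ∉ innerVertices a) (hks : Anc p k s) (hks' : ¬ Anc p k s')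
    (hB : (swap A f a).edgeSet = (A.edgeSet ∪ {e | e ∈ f.edges}) \ {e | e ∈ a.edges}) :
    (swap A f a).Connected := by
  classical
  obtain ⟨hfp, hss', hsA, hsA', hin, hfe⟩ := hf
  set B := swap A f a with hBdef
  have hadj : ∀ v ∈ A.verts, v ≠ r → (∀ j < n, v ≠ p^[j] k) →
      B.spanningCoe.Reachable v (p v) := by
    intro v hv hvr hne
    have : s(v, p v) ∈ B.edgeSet := by
      rw [hB]
      exact ⟨Or.inl (h.adj_parent v hv hvr), h.parent_edge_notMem_segment hk hae hv hvr hne⟩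
    exact Adj.reachable this
  have anc_iter : ∀ j, Anc p (p^[j] k) k := fun j => ⟨j, rfl⟩
  -- Outside the subtree of `k` and the interior of the segment, climbing to the root meets neither.
  have up : ∀ v ∈ A.verts, v ∉ innerVertices a → ¬ Anc p k v →
      B.spanningCoe.Reachable v r := by
    refine h.root_induction (fun _ _ => Reachable.refl _) fun v hv hvr ih hvi hvk => ?_
    refine (hadj v hv hvr fun j hj e => ?_).trans (ih (fun hpi => ?_) fun ha => hvk ha.of_parent)
    · rcases j with _ | j
      · exact hvk (e ▸ Anc.refl p _)
      · exact hvi ((h.mem_innerVertices_segment hk hu has).mpr ⟨j, hj, e⟩)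
    · obtain ⟨j, hj, e⟩ := (h.mem_innerVertices_segment hk hu has).mp hpi
      have hv' := h.child_of_inner hk hj hv hvr e
      rcases j with _ | j
      · exact hvk (hv' ▸ Anc.refl p _)
      · exact hvi ((h.mem_innerVertices_segment hk hu has).mpr ⟨j, by omega, hv'⟩)
  have down : ∀ v ∈ A.verts, Anc p k v → B.spanningCoe.Reachable v k := by
    refine h.root_induction (fun ha => h.anc_root ha ▸ Reachable.refl _)
      fun v hv hvr ih ha => ?_
    by_cases hvk : k = v
    · exact hvk ▸ Reachable.refl _
    · refine (hadj v hv hvr fun j hj e => hvk ?_).trans (ih (ha.eq_or_parent.resolve_left hvk))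
      exact h.anc_antisymm hv ha (e ▸ anc_iter j)
  have along : ∀ x ∈ f.support, B.spanningCoe.Reachable x s' := by
    intro x hx
    refine ⟨(f.dropUntil x hx).transfer _ fun e he => ?_⟩
    have he' := f.edges_dropUntil_subset_edges hx he
    have : e ∈ B.edgeSet := by
      rw [hB]
      exact ⟨Or.inr he', fun hea => hfe e he' (h.edges_segment_mem hk hae e hea)⟩
    rwa [Subgraph.edgeSet_spanningCoe]
  have hs'r := up s' hsA' hs' hks'
  have hr : r ∈ B.verts := by
    rw [hBdef, swap_verts]
    refine ⟨Or.inl h.root_mem, fun hri => ?_⟩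
    obtain ⟨j, hj, e⟩ := (h.mem_innerVertices_segment hk hu has).mp hri
    exact hk.ne_root (j + 1) hj e.symm
  refine connected_of_reachable hr fun v hv => ?_
  rw [hBdef, swap_verts] at hv
  rcases hv.1 with hvA | hvf
  · by_cases ha : Anc p k v
    · exact (down v hvA ha).trans ((down s hsA hks).symm.trans
        ((along s f.start_mem_support).trans hs'r))
    · exact up v hvA hv.2 ha
  · exact (along v hvf).trans hs'r

/-- If no path swap improves `A`, a segment costs at most as much as any path in whose cycle
it lies. -/
theorem walkCost_segment_le_of_isAddable [Fintype V] (h : RootedTree A r p d) {T : Set V}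
    {c : Sym2 V → ℝ} (hA : IsSteinerTree T A) (hTS : T ⊆ S)
    (hopt : ∀ B : G.Subgraph, IsPathSwap T A B → cost c A ≤ cost c B)
    (hk : IsSegment A r p S k n)
    (hu : p^[n] k = u) (has : a.support = (List.range (n + 1)).map (fun j => p^[j] k))
    (hae : a.edges = (List.range n).map (fun j => s(p^[j] k, p^[j + 1] k)))
    {s s' : V} {f : G.Walk s s'} (hf : IsAddable A f)
    (hs : s ∈ S) (hs' : s' ∈ S) (hks : Anc p k s) (hks' : ¬ Anc p k s') :
    walkCost c a ≤ walkCost c f := by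
  classical
  have hf' := hf
  obtain ⟨hfp, hss', hsA, hsA', hin, hfe⟩ := hf'
  have hap : a.IsPath := h.isPath_of_support_eq hk.mem hk.ne_root has
  have hinner : ∀ w ∈ innerVertices a, w ∈ A.verts ∧ w ∉ S := by
    intro w hw
    obtain ⟨j, hj, rfl⟩ := (h.mem_innerVertices_segment hk hu has).mp hw
    exact ⟨h.iterate_mem hk.mem _, hk.notMem _ (by omega) hj⟩
  have haA := h.edges_segment_mem hk hae
  have hku : k ≠ u := by
    intro e
    have := h.iterate_injOn hk.mem hk.ne_root (i := 0) (j := n) (by omega) le_rfl (e.trans hu.symm)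
    have := hk.pos
    omega
  have hB : (swap A f a).edgeSet = (A.edgeSet ∪ {e | e ∈ f.edges}) \ {e | e ∈ a.edges} := by
    refine swap_edgeSet fun e he w hw hwe => ?_
    rcases he with he | he
    · exact h.edge_of_inner hk hu has hae he hw hwe
    · exfalso
      have hwf : w ∈ f.support := f.mem_support_of_mem_edges he hwe
      obtain ⟨hwA, hwS⟩ := hinner w hw
      exact hin w ⟨hwf, fun e => hwS (e ▸ hs), fun e => hwS (e ▸ hs')⟩ hwA
  have hconn := h.connected_swap hk hu has hae hf (fun hi => (hinner s' hi).2 hs') hks hks' hB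
  have htree : IsSteinerTree T (swap A f a) := by
    constructor
    -- Vertex and edge counts both change by `f.length - a.length`, so a connected result is again a
    -- tree.
    · rw [isTree_iff_connected_and_card]
      refine ⟨hconn.coe, ?_⟩
      have h1 := (isTree_iff_connected_and_card.mp hA.1).2
      have h2 := card_swap_verts hf hap hku (by
        intro w hw
        rw [has, List.mem_map] at hw
        obtain ⟨j, -, rfl⟩ := hw
        exact h.iterate_mem hk.mem j)
      have h3 := cost_swap (fun _ => (1 : ℝ)) hfp hap hfe haA hB
      rw [cost_one, cost_one, walkCost_one, walkCost_one] at h3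
      have h4 : Nat.card (swap A f a).coe.edgeSet + a.length = Nat.card A.coe.edgeSet + f.length := by
        exact_mod_cast h3
      omega
    · intro t ht
      rw [swap_verts]
      exact ⟨Or.inl (hA.2 ht), fun hi => (hinner t hi).2 (hTS ht)⟩
  obtain ⟨q, hq⟩ := ((Subgraph.connected_iff_forall_exists_walk_subgraph A).mp
    ⟨hA.1.connected⟩).2 hsA hsA'
  have hqA : q.bypass.toSubgraph ≤ A := Walk.toSubgraph_bypass_le_toSubgraph.trans hq
  -- Every lower endpoint of an edge of the segment separates `s` from `s'`, so the edge lies on the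
  -- tree path between them.
  have hle := hopt _ ⟨s, s', f, q.bypass, k, u, a, hf, ⟨q.bypass_isPath, hqA⟩, ⟨hap, fun e he => by
    rw [hae, List.mem_map] at he
    obtain ⟨j, hj, rfl⟩ := he
    rw [List.mem_range] at hj
    rw [Function.iterate_succ_apply']
    exact Or.inr (h.edge_mem_of_separated ((show Anc p (p^[j] k) k from ⟨j, rfl⟩).trans hks)
      (h.not_anc_iterate hk hj hsA' hs' hks') hqA)⟩, rfl, htree⟩
  have := cost_swap c hfp hap hfe haA hB
  linarith

/-- A piece shortcut to a path is addable unless it uses an edge of `A`. Such an edge must join `s`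
and `s'`, and is then itself the whole segment. -/
theorem walkCost_segment_le [Fintype V] (h : RootedTree A r p d) {T : Set V}
    {c : Sym2 V → ℝ} (hc : ∀ e ∈ G.edgeSet, 0 ≤ c e) (hA : IsSteinerTree T A) (hTS : T ⊆ S)
    (hopt : ∀ B : G.Subgraph, IsPathSwap T A B → cost c A ≤ cost c B)
    (hk : IsSegment A r p S k n)
    (hu : p^[n] k = u) (has : a.support = (List.range (n + 1)).map (fun j => p^[j] k))
    (hae : a.edges = (List.range n).map (fun j => s(p^[j] k, p^[j + 1] k)))
    {s s' : V} {q : G.Walk s s'} (hq : ∀ x ∈ q.support, x ∈ A.verts → x = s ∨ x = s')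
    (hsA : s ∈ A.verts) (hsA' : s' ∈ A.verts)
    (hs : s ∈ S) (hs' : s' ∈ S) (hks : Anc p k s) (hks' : ¬ Anc p k s') :
    walkCost c a ≤ walkCost c q := by
  classical
  refine le_trans ?_ (walkCost_bypass_le hc q)
  have hne : s ≠ s' := by rintro rfl; exact hks' hks
  have hqs : ∀ x ∈ q.bypass.support, x ∈ A.verts → x = s ∨ x = s' :=
    fun x hx => hq x (q.support_bypass_subset_support hx)
  by_cases hfe : ∀ e ∈ q.bypass.edges, e ∉ A.edgeSet
  · refine h.walkCost_segment_le_of_isAddable hA hTS hopt hk hu has hae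
      ⟨q.bypass_isPath, hne, hsA, hsA', ?_, hfe⟩ hs hs' hks hks'
    rintro w ⟨hw, hws, hws'⟩ hwA
    rcases hqs w hw hwA with e | e
    · exact hws e
    · exact hws' e
  · push Not at hfe
    obtain ⟨e, he, heA⟩ := hfe
    have he' : e = s(s, s') := by
      induction e with
      | _ x y =>
        have hadj : A.Adj x y := heA
        have hx := hqs x (Walk.fst_mem_support_of_mem_edges _ he) hadj.fst_mem
        have hy := hqs y (Walk.snd_mem_support_of_mem_edges _ he) hadj.snd_mem
        have := hadj.ne
        rcases hx with rfl | rfl <;> rcases hy with rfl | rfl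
        · exact absurd rfl this
        · rfl
        · exact Sym2.eq_swap
        · exact absurd rfl this
    subst he'
    have hadj : A.Adj s s' := heA
    have hps : p s = s' := (h.parent_of_adj s s' hadj).resolve_right fun e =>
      hks' (Anc.of_parent (e ▸ hks))
    have hsk : k = s := hks.eq_or_parent.resolve_right (hps ▸ hks')
    -- The parent `s'` of `k` is in `S`, where segments stop.
    have hn : n = 1 := by
      by_contra hn
      have := hk.pos
      refine hk.notMem 1 (by omega) (by omega) ?_
      rw [Function.iterate_one, hsk, hps]
      exact hs'
    have hae' : a.edges = [s(s, s')] := by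
      rw [hae, hn]
      simp [hsk, hps]
    have hle : c s(s, s') ≤ (q.bypass.edges.map c).sum := by
      refine List.single_le_sum (fun x hx => ?_) _ (List.mem_map_of_mem he)
      obtain ⟨e, he, rfl⟩ := List.mem_map.mp hx
      exact hc e (Walk.edges_subset_edgeSet _ he)
    simpa [walkCost, hae'] using hle

end RootedTree

/-! ### Covering the tree by segments and summing up -/

theorem walkCost_nonneg {c : Sym2 V → ℝ} (hc : ∀ e ∈ G.edgeSet, 0 ≤ c e) {u v : V}
    (q : G.Walk u v) : 0 ≤ walkCost c q := by
  refine List.sum_nonneg fun x hx => ?_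
  obtain ⟨e, he, rfl⟩ := List.mem_map.mp hx
  exact hc e (q.edges_subset_edgeSet he)

theorem walkCost_reverse (c : Sym2 V → ℝ) {u v : V} (q : G.Walk u v) :
    walkCost c q.reverse = walkCost c q := by
  simp [walkCost, Walk.edges_reverse, List.map_reverse, List.sum_reverse]

theorem cost_nonneg [Fintype V] {c : Sym2 V → ℝ} (hc : ∀ e ∈ G.edgeSet, 0 ≤ c e)
    (H : G.Subgraph) : 0 ≤ cost c H :=
  Finset.sum_nonneg fun _ he => hc _ (H.edgeSet_subset (by simpa using he))

namespace RootedTree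

variable {A : G.Subgraph} {r : V} {p : V → V} {d : V → ℕ}

theorem mem_terminals_or_exists_child (h : RootedTree A r p d) {T : Set V}
    (hleaf : LeavesAreTerminals T A) {v : V} (hv : v ∈ A.verts) (hvr : v ≠ r) :
    v ∈ T ∨ ∃ w ∈ A.verts, w ≠ r ∧ p w = v := by
  by_contra hcon
  push Not at hcon
  refine hcon.1 (hleaf v hv ⟨p v, h.adj_parent v hv hvr, fun y hy => ?_⟩)
  refine ((h.parent_of_adj v y hy).resolve_right fun e => ?_).symm
  refine hcon.2 y hy.snd_mem ?_ e
  rintro rfl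
  exact hvr (e.symm.trans h.parent_root)

/-- Descending from a non-root vertex ends at a leaf. For `T` empty, this forces `A` to be a single
vertex. -/
theorem exists_mem_terminals [Finite V] (h : RootedTree A r p d) {T : Set V}
    (hleaf : LeavesAreTerminals T A) : ∀ v ∈ A.verts, v ≠ r → T.Nonempty := by
  refine h.leaf_induction fun v hv ih hvr => ?_
  rcases h.mem_terminals_or_exists_child hleaf hv hvr with ht | ⟨w, hw, hwr, e⟩
  · exact ⟨v, ht⟩
  · exact ih w hw hwr e hwr

theorem exists_isSegment (h : RootedTree A r p d) {S : Set V} (hrS : r ∈ S) {k : V}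
    (hk : k ∈ A.verts) (hkr : k ≠ r) :
    ∃ n, IsSegment A r p S k n ∧ (p^[n] k ∈ S ∨ IsBranch A r p (p^[n] k)) := by
  classical
  -- The least such `n` is taken; the root, which is in `S`, ensures that one exists.
  have hex : ∃ n, 0 < n ∧ (p^[n] k ∈ S ∨ IsBranch A r p (p^[n] k)) := by
    obtain ⟨m, hm⟩ := h.root_anc hk
    refine ⟨m, Nat.pos_of_ne_zero ?_, Or.inl (hm ▸ hrS)⟩
    rintro rfl
    exact hkr hm
  obtain ⟨h1, h2⟩ := Nat.find_spec hex
  have h3 : ∀ j, 0 < j → j < Nat.find hex → ¬ (p^[j] k ∈ S ∨ IsBranch A r p (p^[j] k)) :=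
    fun j hj hlt hcon => Nat.find_min hex hlt ⟨hj, hcon⟩
  refine ⟨Nat.find hex, ⟨hk, h1, fun j hj => ?_, fun j hj hlt hS => h3 j hj hlt (Or.inl hS),
    fun j hj hlt hb => h3 j hj hlt (Or.inr hb)⟩, h2⟩
  rcases Nat.eq_zero_or_pos j with rfl | hpos
  · exact hkr
  · intro e
    exact h3 j hpos hj (Or.inl (e ▸ hrS))

/-- Every edge of `A` lies on one of the segments. -/
theorem exists_segment_through [Finite V] (h : RootedTree A r p d) {S : Set V}
    (hS : ∀ v ∈ A.verts, v ∈ S ∨ ∃ w ∈ A.verts, w ≠ r ∧ p w = v) {K : Finset V}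
    (hK : ∀ v ∈ A.verts, v ≠ r → v ∈ S ∨ IsBranch A r p v → v ∈ K) {N : K → ℕ}
    (hN : ∀ k : K, 0 < N k ∧ (p^[N k] (k : V) ∈ S ∨ IsBranch A r p (p^[N k] (k : V)))) :
    ∀ v ∈ A.verts, v ≠ r → ∃ k : K, ∃ j < N k, p^[j] (k : V) = v := by
  refine h.leaf_induction fun v hv ih hvr => ?_
  by_cases hkey : v ∈ S ∨ IsBranch A r p v
  · exact ⟨⟨v, hK v hv hvr hkey⟩, 0, (hN _).1, rfl⟩
  · obtain ⟨w, hw, hwr, hwv⟩ := (hS v hv).resolve_left fun hs => hkey (Or.inl hs)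
    obtain ⟨k, j, hj, rfl⟩ := ih w hw hwr hwv hwr
    rw [← Function.iterate_succ_apply' p] at hwv
    refine ⟨k, j + 1, lt_of_le_of_ne hj fun e => hkey ?_, hwv⟩
    rw [← hwv, show j.succ = N k from e]
    exact (hN k).2

/-- Every edge joins a non-root vertex to its parent. Covering suffices: with nonnegative costs,
overlaps only increase the right side. -/
theorem cost_le_sum_segments [Fintype V] (h : RootedTree A r p d) {c : Sym2 V → ℝ}
    (hc : ∀ e ∈ G.edgeSet, 0 ≤ c e) {K : Finset V} {N : K → ℕ} (hKA : ∀ k ∈ K, k ∈ A.verts)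
    (hNr : ∀ k : K, ∀ j < N k, p^[j] (k : V) ≠ r)
    (hcov : ∀ v ∈ A.verts, v ≠ r → ∃ k : K, ∃ j < N k, p^[j] (k : V) = v) :
    cost c A ≤ ∑ k : K, ∑ j ∈ Finset.range (N k), c s(p^[j] (k : V), p^[j + 1] (k : V)) := by
  classical
  let φ : (Σ _ : K, ℕ) → Sym2 V := fun x => s(p^[x.2] (x.1 : V), p^[x.2 + 1] (x.1 : V))
  let I : Finset (Σ _ : K, ℕ) := Finset.univ.sigma fun k => Finset.range (N k)
  have hmem : ∀ e ∈ I.image φ, e ∈ A.edgeSet := by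
    intro e he
    obtain ⟨⟨k, j⟩, hx, rfl⟩ := Finset.mem_image.mp he
    have hj := Finset.mem_range.mp (Finset.mem_sigma.mp hx).2
    change A.Adj (p^[j] (k : V)) (p^[j + 1] (k : V))
    rw [Function.iterate_succ_apply']
    exact h.adj_parent _ (h.iterate_mem (hKA k k.2) j) (hNr k j hj)
  have hpar : ∀ v ∈ A.verts, v ≠ r → s(v, p v) ∈ I.image φ := by
    intro v hv hvr
    obtain ⟨k, j, hj, rfl⟩ := hcov v hv hvr
    refine Finset.mem_image.mpr ⟨⟨k, j⟩,
      Finset.mem_sigma.mpr ⟨Finset.mem_univ _, Finset.mem_range.mpr hj⟩, ?_⟩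
    change s(p^[j] (k : V), p^[j + 1] (k : V)) = _
    rw [Function.iterate_succ_apply']
  have hsub : A.edgeSet.toFinset ⊆ I.image φ := by
    intro e he
    rw [Set.mem_toFinset] at he
    induction e with
    | _ x y =>
      have hadj : A.Adj x y := he
      rcases h.parent_of_adj x y hadj with e | e
      · have := hpar x hadj.fst_mem (by rintro rfl; exact hadj.ne (h.parent_root.symm.trans e))
        rwa [e] at this
      · have := hpar y hadj.snd_mem (by rintro rfl; exact hadj.ne (e.symm.trans h.parent_root))
        rwa [e, Sym2.eq_swap] at this
  have hnn : ∀ e ∈ I.image φ, 0 ≤ c e := fun e he => hc e (A.edgeSet_subset (hmem e he))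
  calc cost c A ≤ ∑ e ∈ I.image φ, c e :=
        Finset.sum_le_sum_of_subset_of_nonneg hsub fun e he _ => hnn e he
    _ ≤ ∑ x ∈ I, c (φ x) := Finset.sum_image_le_of_nonneg hnn
    _ = _ := Finset.sum_sigma _ _ _

end RootedTree

theorem sum_map_range (f : ℕ → ℝ) (n : ℕ) :
    ((List.range n).map f).sum = ∑ j ∈ Finset.range n, f j := by
  induction n with
  | zero => simp
  | succ n ih => rw [List.range_succ, Finset.sum_range_succ, List.map_append, List.sum_append, ih]; simp

theorem sum_le_two_mul_sum_of_injective {ι : Type*} [Fintype ι] {n : ℕ} {w : ℕ → ℝ}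
    (hw : ∀ i < n, 0 ≤ w i) {g : ι → ℕ × Bool} (hg : Function.Injective g)
    (hgn : ∀ k, (g k).1 < n) : ∑ k, w (g k).1 ≤ 2 * ∑ i ∈ Finset.range n, w i := by
  classical
  calc ∑ k, w (g k).1 = ∑ x ∈ Finset.univ.image g, w x.1 :=
        (Finset.sum_image (f := fun x : ℕ × Bool => w x.1) fun _ _ _ _ e => hg e).symm
    _ ≤ ∑ x ∈ Finset.range n ×ˢ (Finset.univ : Finset Bool), w x.1 := by
        refine Finset.sum_le_sum_of_subset_of_nonneg (fun x hx => ?_) fun x hx _ => ?_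
        · obtain ⟨k, -, rfl⟩ := Finset.mem_image.mp hx
          exact Finset.mem_product.mpr ⟨Finset.mem_range.mpr (hgn k), Finset.mem_univ _⟩
        · exact hw _ (Finset.mem_range.mp (Finset.mem_product.mp hx).1)
    _ = 2 * ∑ i ∈ Finset.range n, w i := by
        rw [Finset.sum_product, Finset.mul_sum]
        simp

/-- The approximation guarantee for an instance with at least one terminal. -/
theorem cost_le_of_mem_terminals [Fintype V] {T : Set V}
    {c : Sym2 V → ℝ} (hc : ∀ e ∈ G.edgeSet, 0 ≤ c e)
    {A : G.Subgraph} (hA : IsSteinerTree T A) (hleaf : LeavesAreTerminals T A)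
    (hopt : ∀ B : G.Subgraph, IsPathSwap T A B → cost c A ≤ cost c B)
    {F : G.Subgraph} (hF : IsSolution T F) {r : V} (hrT : r ∈ T) :
    cost c A ≤ 4 * cost c F := by
  classical
  obtain ⟨p, d, h⟩ := exists_rootedTree hA.1 (hA.2 hrT)
  obtain ⟨W, hWF, hWc⟩ := exists_closed_walk hc hF.1 (hF.2 hrT)
  obtain ⟨n, s, w, q₀, hq₀, hsA, hpc, hWs, hsum⟩ := exists_pieces c A.verts W (hA.2 hrT)
  -- The walk starts in `A`, so the first visit is `r` itself.
  have hs0 : s 0 = r := (hq₀ r q₀.start_mem_support (hA.2 hrT)).symm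
  set S : Set V := {v | ∃ i ≤ n, s i = v} with hSdef
  have hTS : T ⊆ S := fun t ht => hWs t (hWF t (hF.2 ht)) (hA.2 ht)
  have hS : ∀ v ∈ A.verts, v ∈ S ∨ ∃ w ∈ A.verts, w ≠ r ∧ p w = v := by
    intro v hv
    by_cases hvr : v = r
    · exact Or.inl (hvr ▸ hTS hrT)
    · exact (h.mem_terminals_or_exists_child hleaf hv hvr).imp_left fun ht => hTS ht
  have hw : ∀ i < n, 0 ≤ w i := by
    intro i hi
    obtain ⟨q, -, hq⟩ := hpc i hi
    exact (walkCost_nonneg hc q).trans hq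
  let K : Finset V := Finset.univ.filter fun v => v ∈ A.verts ∧ v ≠ r ∧ (v ∈ S ∨ IsBranch A r p v)
  have hK : ∀ v ∈ K, v ∈ A.verts ∧ v ≠ r ∧ (v ∈ S ∨ IsBranch A r p v) :=
    fun v hv => (Finset.mem_filter.mp hv).2
  choose N hNseg hNkey using fun k : K =>
    h.exists_isSegment (hTS hrT) (hK k k.2).1 (hK k k.2).2.1
  obtain ⟨g, hg, hgs⟩ := h.exists_assignment hs0 hS (fun v hv => (hK v hv).1)
    (fun v hv => (hK v hv).2.1) fun v hv => (hK v hv).2.2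
  have hcov := h.exists_segment_through hS (K := K)
    (fun v hv hvr hkey => Finset.mem_filter.mpr ⟨Finset.mem_univ v, hv, hvr, hkey⟩)
    fun k => ⟨(hNseg k).pos, hNkey k⟩
  have hseg : ∀ k : K, ∑ j ∈ Finset.range (N k), c s(p^[j] (k : V), p^[j + 1] (k : V)) ≤
      w (g k).1 := by
    intro k
    obtain ⟨a, has, hae⟩ := h.exists_walk_up (hK k k.2).1 (hNseg k).ne_root rfl
    have hcost : ∑ j ∈ Finset.range (N k), c s(p^[j] (k : V), p^[j + 1] (k : V)) =
        walkCost c a := by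
      rw [walkCost, hae, List.map_map, ← sum_map_range]
      rfl
    obtain ⟨hlt, hsep⟩ := hgs k
    obtain ⟨q, hq, hqw⟩ := hpc _ hlt
    rw [hcost]
    refine le_trans ?_ hqw
    have hm := hsA _ hlt.le
    have hm' := hsA _ (Nat.succ_le_of_lt hlt)
    have hmS : s (g k).1 ∈ S := ⟨_, hlt.le, rfl⟩
    have hmS' : s ((g k).1 + 1) ∈ S := ⟨_, Nat.succ_le_of_lt hlt, rfl⟩
    rcases hsep with ⟨h1, h2⟩ | ⟨h1, h2⟩
    · exact h.walkCost_segment_le hc hA hTS hopt (hNseg k) rfl has hae hq hm hm' hmS hmS' h1 h2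
    -- Here the later end is the one below `k`, so the piece is reversed.
    · rw [← walkCost_reverse c q]
      refine h.walkCost_segment_le hc hA hTS hopt (hNseg k) rfl has hae (fun x hx hxA => ?_)
        hm' hm hmS' hmS h2 h1
      exact (hq x (by simpa using hx) hxA).symm
  have h1 := h.cost_le_sum_segments hc (fun k hk => (hK k hk).1) (fun k => (hNseg k).ne_root) hcov
  have h2 := Finset.sum_le_sum fun k (_ : k ∈ Finset.univ) => hseg k
  have h3 := sum_le_two_mul_sum_of_injective hw hg fun k => (hgs k).1
  have h4 := walkCost_nonneg hc q₀
  linarith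

end SteinerLocalSearch

theorem mainTheorem6 {V : Type*} [Fintype V] (G : SimpleGraph V) (T : Set V)
    (c : Sym2 V → ℝ) (hc : ∀ e ∈ G.edgeSet, 0 ≤ c e)
    (A : G.Subgraph) (hA : SteinerLocalSearch.IsSteinerTree T A)
    (hleaf : SteinerLocalSearch.LeavesAreTerminals T A)
    (hopt : ∀ B : G.Subgraph, SteinerLocalSearch.IsPathSwap T A B →
      SteinerLocalSearch.cost c A ≤ SteinerLocalSearch.cost c B)
    (F : G.Subgraph) (hF : SteinerLocalSearch.IsSolution T F) :
    SteinerLocalSearch.cost c A ≤ 4 * SteinerLocalSearch.cost c F := by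
  classical
  rcases T.eq_empty_or_nonempty with hT | ⟨r, hr⟩
  · obtain ⟨r, hr⟩ := hA.1.connected.nonempty
    obtain ⟨p, d, h⟩ := SteinerLocalSearch.exists_rootedTree hA.1 hr
    have hone : ∀ v ∈ A.verts, v = r := by
      intro v hv
      by_contra hvr
      exact (h.exists_mem_terminals hleaf v hv hvr).ne_empty hT
    have hzero : SteinerLocalSearch.cost c A = 0 := by
      refine Finset.sum_eq_zero fun e he => ?_
      rw [Set.mem_toFinset] at he
      induction e with
      | _ x y =>
        have hadj : A.Adj x y := he
        exact absurd ((hone x hadj.fst_mem).trans (hone y hadj.snd_mem).symm) hadj.ne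
    have := SteinerLocalSearch.cost_nonneg hc F
    linarith
  · exact SteinerLocalSearch.cost_le_of_mem_terminals hc hA hleaf hopt hF hr
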